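/- **Setting.** Let $Q=(a_1^-,a_1^+)\times(a_2^-,a_2^+)\times(a_3^-,a_3^+)$ be an open cuboid that is divided by planes parallel to the $x_2$-$x_3$-plane into a chain of cuboids $\tilde Q_1,\dots,\tilde Q_L$. Each $\tilde Q_i$ contains $K$ nonempty open subdomains $\tilde Q_{i,1},\dots,\tilde Q_{i,K}$; each of them is the interior of the closure of a finite union of cuboids contained in $\tilde Q_i$ that have faces parallel to the coordinate planes and reach from the bottom $\{x_3=a_3^-\}$ to the top $\{x_3=a_3^+\}$ of $Q$. The closures of $\tilde Q_{i,1},\dots,\tilde Q_{i,K}$ are pairwise disjoint and do not meet the planes that separate the cuboids of the chain. Let $\tilde Q_{i,0}:=\tilde Q_i\setminus\bigcup_{l=1}^K\overline{\tilde Q_{i,l}}$, and let the permittivity $\varepsilon$ be equal to a positive constant $\varepsilon|_{\tilde Q_{i,j}}$ on each $\tilde Q_{i,j}$, $i\in\{1,\dots,L\}$, $j\in\{0,\dots,K\}$. Let $e=\{(p_1,p_2)\}\times(a_3^-,a_3^+)\subset Q$ be a line segment such that each of the four sufficiently thin open cuboids adjacent to $e$ (one in each of the four quadrants around $(p_1,p_2)$,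 with the height of $Q$) is contained in one of the sets $\tilde Q_{i,j}$. Let $\varepsilon_{\mathrm{in}}^{(1)},\dots,\varepsilon_{\mathrm{in}}^{(4)}$ be the values of $\varepsilon$ on these four cuboids, listed counterclockwise starting with any of them, and assume $$\varepsilon_{\mathrm{in}}^{(1)}=\varepsilon_{\mathrm{in}}^{(2)}=\varepsilon_{\mathrm{in}}^{(3)}\neq\varepsilon_{\mathrm{in}}^{(4)}.$$ Consider the eigenvalue problem for piecewise smooth real functions $\psi=(\psi^{(1)},\dots,\psi^{(4)})$, with $\psi^{(i)}$ defined on the closure of $I_i:=\big(\tfrac{(i-1)\pi}{2},\tfrac{i\pi}{2}\big)$, $$\begin{aligned} &(\psi^{(i)})''=-\kappa^2\psi^{(i)}\quad\text{on } I_i,\ i\in\{1,\dots,4\},\\ &\varepsilon_{\mathrm{in}}^{(1)}\psi^{(1)}(0)=\varepsilon_{\mathrm{in}}^{(4)}\psi^{(4)}(2\pi),\quad (\psi^{(1)})'(0)=(\psi^{(4)})'(2\pi),\\ &\psi^{(1)}(\tfrac{\pi}{2})=\psi^{(2)}(\tfrac{\pi}{2}),\quad (\psi^{(1)})'(\tfrac{\pi}{2})=(\psi^{(2)})'(\tfrac{\pi}{2}),\\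 &\psi^{(2)}(\pi)=\psi^{(3)}(\pi),\quad (\psi^{(2)})'(\pi)=(\psi^{(3)})'(\pi),\\ &\psi^{(3)}(\tfrac{3\pi}{2})=\psi^{(4)}(\tfrac{3\pi}{2}),\quad \varepsilon_{\mathrm{in}}^{(1)}(\psi^{(3)})'(\tfrac{3\pi}{2})=\varepsilon_{\mathrm{in}}^{(4)}(\psi^{(4)})'(\tfrac{3\pi}{2}). \end{aligned}$$ Denote by $\kappa_1^2\le\kappa_2^2\le\dots$, with $\kappa_n\ge0$, its eigenvalues in nondecreasing order, repeated according to multiplicity. Let further $\mathring\kappa\in[0,\tfrac13)$ be the number with $$\max_{\substack{1\le i\le L\\ 1\le l\le K}}\frac{(\varepsilon|_{\tilde Q_{i,l}}-\varepsilon|_{\tilde Q_{i,0}})^2}{\varepsilon|_{\tilde Q_{i,l}}\,\varepsilon|_{\tilde Q_{i,0}}}=\frac{4\sin^2(\mathring\kappa\pi)}{\cos(\tfrac32\mathring\kappa\pi)\cos(\tfrac12\mathring\kappa\pi)}.$$ **Lemma 3.3.** The numbers $\mathring\kappa$, $\kappa_1$ and $\kappa_2$ are well defined (each exists and is unique), and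 $$\kappa_1\le\mathring\kappa<1\le\kappa_2.$$ -/

import Mathlib

open Set

/-! ### The material domain -/

/-- The open cuboid with lower corner `a` and upper corner `b` in `ℝ³`; the indices `0, 1, 2` stand
for the coordinates `x₁, x₂, x₃`. -/
def cuboid (a b : Fin 3 → ℝ) : Set (Fin 3 → ℝ) :=
  {x | ∀ j, a j < x j ∧ x j < b j}

/-- The geometry and the electric permittivity: a cuboid `Q` is cut by planes parallel to the
`x₂`-`x₃`-plane into a chain of `L` cuboids (`slab`), each of which contains `K` separated embedded
subdomains (`sub`) that reach from the bottom to the top of `Q`. -/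
structure MaterialDomain (L K : ℕ) where
  /-- the numbers `a₁⁻, a₂⁻, a₃⁻` -/
  lo : Fin 3 → ℝ
  /-- the numbers `a₁⁺, a₂⁺, a₃⁺` -/
  hi : Fin 3 → ℝ
  lo_lt_hi : ∀ j, lo j < hi j
  /-- the `x₁`-coordinates of the planes that bound the cuboids of the chain -/
  cut : Fin (L + 1) → ℝ
  cut_strictMono : StrictMono cut
  cut_zero : cut 0 = lo 0
  cut_last : cut (Fin.last L) = hi 0
  /-- the embedded subdomains: `sub i l` is the `l`-th one in the `i`-th cuboid of the chain -/
  sub : Fin L → Fin K → Set (Fin 3 → ℝ)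
  /-- Each subdomain is made of finitely many cuboids that lie in the respective cuboid of the chain
  and touch the bottom and the top of `Q` (the interior of the closure adds the open interfaces
  between adjacent grid elements). -/
  sub_grid : ∀ i l, ∃ G : Set (Set (Fin 3 → ℝ)), G.Finite ∧ G.Nonempty ∧
    (∀ C ∈ G, ∃ a b : Fin 3 → ℝ, (∀ j, a j < b j) ∧
      cut i.castSucc ≤ a 0 ∧ b 0 ≤ cut i.succ ∧ lo 1 ≤ a 1 ∧ b 1 ≤ hi 1 ∧
      a 2 = lo 2 ∧ b 2 = hi 2 ∧ C = cuboid a b) ∧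
    sub i l = interior (closure (⋃₀ G))
  /-- The subdomains of one cuboid of the chain are separated. -/
  sub_separated : ∀ i l l', l ≠ l' → Disjoint (closure (sub i l)) (closure (sub i l'))
  /-- The subdomains stay away from the interfaces between the cuboids of the chain. -/
  sub_away : ∀ i l (m : Fin (L + 1)), m ≠ 0 → m ≠ Fin.last L →
    ∀ x ∈ closure (sub i l), x 0 ≠ cut m
  /-- the constant value of the permittivity on each submedium; the index `0` in the second argument
  belongs to the remainder, the index `l + 1` to the `l`-th embedded subdomain -/
  eps : Fin L → Fin (K + 1) → ℝ
  eps_pos : ∀ i j, 0 < eps i j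

namespace MaterialDomain

variable {L K : ℕ} (M : MaterialDomain L K)

/-- The `i`-th cuboid of the chain. -/
def slab (i : Fin L) : Set (Fin 3 → ℝ) :=
  {x | (M.cut i.castSucc < x 0 ∧ x 0 < M.cut i.succ) ∧ (M.lo 1 < x 1 ∧ x 1 < M.hi 1) ∧
    (M.lo 2 < x 2 ∧ x 2 < M.hi 2)}

/-- The submedia of the `i`-th cuboid of the chain: the index `0` gives the remainder of the cuboid
outside of the embedded subdomains, the index `l + 1` the `l`-th embedded subdomain. -/
def submedium (i : Fin L) (j : Fin (K + 1)) : Set (Fin 3 → ℝ) :=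
  Fin.cases (motive := fun _ => Set (Fin 3 → ℝ)) (M.slab i \ ⋃ l, closure (M.sub i l)) (M.sub i) j

/-- The four open cuboids of side length `r` in the `x₁`- and `x₂`-direction, and as high as `Q`, that
are adjacent to the edge `{(p 0, p 1)} × (a₃⁻, a₃⁺)`, numbered counterclockwise, beginning with the
quadrant `x₁ > p 0`, `x₂ > p 1`. -/
def quadrant (p : Fin 2 → ℝ) (r : ℝ) (m : Fin 4) : Set (Fin 3 → ℝ) :=
  match m with
  | 0 => cuboid ![p 0, p 1, M.lo 2] ![p 0 + r, p 1 + r, M.hi 2]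
  | 1 => cuboid ![p 0 - r, p 1, M.lo 2] ![p 0, p 1 + r, M.hi 2]
  | 2 => cuboid ![p 0 - r, p 1 - r, M.lo 2] ![p 0, p 1, M.hi 2]
  | 3 => cuboid ![p 0, p 1 - r, M.lo 2] ![p 0 + r, p 1, M.hi 2]

/-- `epsIn` lists the values of the permittivity on the four cuboids around the edge
`{(p 0, p 1)} × (a₃⁻, a₃⁺)` in the interior of `Q`, in counterclockwise order. The first one may be any
of the four (rotation by `k` quarter turns). -/
def IsEdgeRepresentative (p : Fin 2 → ℝ) (epsIn : Fin 4 → ℝ) : Prop :=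
  (M.lo 0 < p 0 ∧ p 0 < M.hi 0) ∧ (M.lo 1 < p 1 ∧ p 1 < M.hi 1) ∧
  ∃ r : ℝ, 0 < r ∧ ∃ k : Fin 4, ∀ m : Fin 4, ∃ i j,
    M.quadrant p r (m + k) ⊆ M.submedium i j ∧ epsIn m = M.eps i j

/-- The relative jump of the permittivity between an embedded subdomain and its surrounding. -/
noncomputable def relJump (i : Fin L) (l : Fin K) : ℝ :=
  (M.eps i l.succ - M.eps i 0) ^ 2 / (M.eps i l.succ * M.eps i 0)

/-- `κ` is the number in `[0, 1/3)` that is defined through the maximal relative jump. -/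
def IsCriticalExponent (κ : ℝ) : Prop :=
  κ ∈ Ico (0 : ℝ) (1 / 3) ∧
  IsGreatest (range fun q : Fin L × Fin K => M.relJump q.1 q.2)
    (4 * Real.sin (κ * Real.pi) ^ 2 /
      (Real.cos (3 / 2 * κ * Real.pi) * Real.cos (1 / 2 * κ * Real.pi)))

end MaterialDomain

/-! ### The angular eigenvalue problem -/

/-- The closures of the four intervals `(0, π/2), (π/2, π), (π, 3π/2), (3π/2, 2π)`. -/
noncomputable def angleInterval (i : Fin 4) : Set ℝ :=
  Icc ((i : ℕ) * (Real.pi / 2)) (((i : ℕ) + 1) * (Real.pi / 2))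

/-- `ψ = (ψ 0, ψ 1, ψ 2, ψ 3)` solves `ψᵢ'' = -lam ψᵢ` on the four intervals, together with the
transmission conditions. Derivatives at the endpoints are one-sided, and `dψ` is the derivative of
`ψ`. Each `ψ i` is a function on the `i`-th closed interval, extended by zero to `ℝ`. -/
def IsAngularSolution (epsIn : Fin 4 → ℝ) (lam : ℝ) (ψ : Fin 4 → ℝ → ℝ) : Prop :=
  (∀ i, ∀ t, t ∉ angleInterval i → ψ i t = 0) ∧
  ∃ dψ : Fin 4 → ℝ → ℝ,
    (∀ i, ∀ t ∈ angleInterval i,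
      HasDerivWithinAt (ψ i) (dψ i t) (angleInterval i) t ∧
      HasDerivWithinAt (dψ i) (-lam * ψ i t) (angleInterval i) t) ∧
    (epsIn 0 * ψ 0 0 = epsIn 3 * ψ 3 (2 * Real.pi) ∧ dψ 0 0 = dψ 3 (2 * Real.pi)) ∧
    (ψ 0 (Real.pi / 2) = ψ 1 (Real.pi / 2) ∧ dψ 0 (Real.pi / 2) = dψ 1 (Real.pi / 2)) ∧
    (ψ 1 Real.pi = ψ 2 Real.pi ∧ dψ 1 Real.pi = dψ 2 Real.pi) ∧
    (ψ 2 (3 / 2 * Real.pi) = ψ 3 (3 / 2 * Real.pi) ∧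
      epsIn 0 * dψ 2 (3 / 2 * Real.pi) = epsIn 3 * dψ 3 (3 / 2 * Real.pi))

/-- The space of all solutions of the angular problem with parameter `lam`; `lam` is an eigenvalue
when this space is nonzero, and its dimension is the multiplicity. -/
def angularEigenspace (epsIn : Fin 4 → ℝ) (lam : ℝ) : Submodule ℝ (Fin 4 → ℝ → ℝ) where
  carrier := {ψ | IsAngularSolution epsIn lam ψ}
  zero_mem' := by
    refine ⟨fun i t _ => rfl, fun _ _ => 0, fun i t _ => ?_, ?_⟩
    · constructor
      · exact hasDerivWithinAt_const t _ (0 : ℝ)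
      · simpa using hasDerivWithinAt_const t (angleInterval i) (0 : ℝ)
    · simp
  add_mem' := by
    rintro ψ φ ⟨h0, d, hd, ⟨h1, h1'⟩, ⟨h2, h2'⟩, ⟨h3, h3'⟩, h4, h4'⟩
      ⟨g0, e, he, ⟨g1, g1'⟩, ⟨g2, g2'⟩, ⟨g3, g3'⟩, g4, g4'⟩
    refine ⟨fun i t ht => by simp [h0 i t ht, g0 i t ht], fun i t => d i t + e i t,
      fun i t ht => ⟨(hd i t ht).1.add (he i t ht).1, ?_⟩, ?_⟩
    · have h := (hd i t ht).2.add (he i t ht).2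
      have hs : -lam * (ψ + φ) i t = -lam * ψ i t + -lam * φ i t := by
        simp only [Pi.add_apply]; ring
      rw [hs]
      exact h
    · simp only [Pi.add_apply]
      refine ⟨⟨?_, ?_⟩, ⟨?_, ?_⟩, ⟨?_, ?_⟩, ?_, ?_⟩ <;> linarith
  smul_mem' := by
    rintro c ψ ⟨h0, d, hd, ⟨h1, h1'⟩, ⟨h2, h2'⟩, ⟨h3, h3'⟩, h4, h4'⟩
    refine ⟨fun i t ht => by simp [h0 i t ht], fun i t => c * d i t,
      fun i t ht => ⟨(hd i t ht).1.const_mul c, ?_⟩, ?_⟩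
    · have h := (hd i t ht).2.const_mul c
      have hs : -lam * (c • ψ) i t = c * (-lam * ψ i t) := by
        simp only [Pi.smul_apply, smul_eq_mul]; ring
      rw [hs]
      exact h
    · simp only [Pi.smul_apply, smul_eq_mul]
      refine ⟨⟨?_, ?_⟩, ⟨?_, ?_⟩, ⟨?_, ?_⟩, ?_, ?_⟩
      · linear_combination c * h1
      · rw [h1']
      · rw [h2]
      · rw [h2']
      · rw [h3]
      · rw [h3']
      · rw [h4]
      · linear_combination c * h4'

/-- `lam` is the `n`-th smallest eigenvalue (`n = 1, 2, …`), eigenvalues being repeated according to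
their multiplicity: the eigenspaces below `lam` span a space of dimension less than `n`, while those
up to and including `lam` span one of dimension at least `n`. -/
def IsNthAngularEigenvalue (epsIn : Fin 4 → ℝ) (n : ℕ) (lam : ℝ) : Prop :=
  Module.rank ℝ ↥(⨆ (lam' : ℝ) (_ : lam' < lam), angularEigenspace epsIn lam') < (n : Cardinal) ∧
  (n : Cardinal) ≤ Module.rank ℝ ↥(⨆ (lam' : ℝ) (_ : lam' ≤ lam), angularEigenspace epsIn lam')

/-- `κ` is the number `κₙ`: the nonnegative root of the `n`-th eigenvalue `κₙ²`. -/
def IsNthAngularExponent (epsIn : Fin 4 → ℝ) (n : ℕ) (κ : ℝ) : Prop :=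
  0 ≤ κ ∧ IsNthAngularEigenvalue epsIn n (κ ^ 2)

/-! On each quarter circle the differential equation acts as a transfer matrix built from `y = C (π
/ 2)` and `s = S (π / 2)`. The first three media agree, so nothing jumps at the angles π/2 and π,
and three quarters yield the triple-angle values `4 * y ^ 3 - 3 * y` and `s * (4 * y ^ 2 - 1)`. What
remains is a 2×2 linear system for the initial data (`IsCompatible`), with determinant `-(y ^ 2 *
charFactor a b (y ^ 2))`.

For `lam ≤ 0` one has `y ^ 2 ≥ 1`, and the determinant is nonzero because `a ≠ b`. For `lam = κ ^ 2`
with 0 < κ < 1, y = cos(κπ/2) is nonzero, and with J = (a - b)²/(ab) the other factor vanishes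
exactly if cos(κπ) = (8 + J)/(8 + 2J), that is, κ = `jumpExponent J`; this eigenvalue is simple. At
κ = 1, y = 0 and the system is void. Hence κ₁ = `jumpExponent J` and κ₂ = 1.

The equation for the critical exponent reduces to the same relation, with the maximal relative jump
in place of J (`jump_eq_iff`). As `jumpExponent` is monotone, it remains to see that J is one of the
relative jumps. The deviating quadrant and its neighbour in the x₂-direction lie in the same cuboid
of the chain, in different submedia that touch; since embedded subdomains are separated, one of the
two is the remainder (`exists_relJump_of_adjacent`). -/

/-! ### Fundamental solutions and transfer of initial data -/

/-- `C` and `S` are the solutions of `f'' = -lam f` with `C 0 = 1`, `C' 0 = 0` and `S 0 = 0`,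
`S' 0 = 1`. -/
structure IsFundamentalPair (lam : ℝ) (C S : ℝ → ℝ) : Prop where
  deriv_C : ∀ t, HasDerivAt C (-lam * S t) t
  deriv_S : ∀ t, HasDerivAt S (C t) t
  C_zero : C 0 = 1
  S_zero : S 0 = 0

theorem isFundamentalPair_cos {κ : ℝ} (hκ : κ ≠ 0) :
    IsFundamentalPair (κ ^ 2) (fun t => Real.cos (κ * t)) (fun t => Real.sin (κ * t) / κ) where
  deriv_C t := by
    have h := ((hasDerivAt_id t).const_mul κ).cos
    simp only [id] at h
    refine h.congr_deriv ?_
    field_simp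
  deriv_S t := by
    have h := (((hasDerivAt_id t).const_mul κ).sin).div_const κ
    simp only [id] at h
    refine h.congr_deriv ?_
    field_simp
  C_zero := by simp
  S_zero := by simp

theorem isFundamentalPair_cosh {μ : ℝ} (hμ : μ ≠ 0) :
    IsFundamentalPair (-μ ^ 2) (fun t => Real.cosh (μ * t)) (fun t => Real.sinh (μ * t) / μ) where
  deriv_C t := by
    have h := ((hasDerivAt_id t).const_mul μ).cosh
    simp only [id] at h
    refine h.congr_deriv ?_
    field_simp
  deriv_S t := by
    have h := (((hasDerivAt_id t).const_mul μ).sinh).div_const μ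
    simp only [id] at h
    refine h.congr_deriv ?_
    field_simp
  C_zero := by simp
  S_zero := by simp

theorem isFundamentalPair_zero : IsFundamentalPair 0 (fun _ => 1) (fun t => t) where
  deriv_C t := by simpa using hasDerivAt_const t (1 : ℝ)
  deriv_S t := hasDerivAt_id t
  C_zero := rfl
  S_zero := rfl

theorem exists_isFundamentalPair_of_nonpos {lam : ℝ} (h : lam ≤ 0) :
    ∃ C S, IsFundamentalPair lam C S := by
  rcases h.lt_or_eq with h | rfl
  · have hs : lam = -Real.sqrt (-lam) ^ 2 := by rw [Real.sq_sqrt (by linarith)]; ring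
    have := isFundamentalPair_cosh (Real.sqrt_ne_zero'.2 (by linarith : 0 < -lam))
    rw [← hs] at this
    exact ⟨_, _, this⟩
  · exact ⟨_, _, isFundamentalPair_zero⟩

namespace IsFundamentalPair

variable {lam : ℝ} {C S : ℝ → ℝ}

/-- Conservation of energy: the derivative of the left-hand side vanishes. This is the Pythagorean
identity for every sign of `lam`. -/
theorem sq_add (h : IsFundamentalPair lam C S) (t : ℝ) : C t ^ 2 + lam * S t ^ 2 = 1 := by
  have hd : ∀ x, HasDerivAt (fun x => C x ^ 2 + lam * S x ^ 2) 0 x := fun x => by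
    have := ((h.deriv_C x).pow 2).add (((h.deriv_S x).pow 2).const_mul lam)
    refine this.congr_deriv ?_
    simp
    ring
  have := is_const_of_deriv_eq_zero (fun x => (hd x).differentiableAt) (fun x => (hd x).deriv) t 0
  simpa [h.C_zero, h.S_zero] using this

/-- Solutions of the differential equation on an interval are determined by their initial data. -/
theorem propagate (h : IsFundamentalPair lam C S) {a b : ℝ} {f df : ℝ → ℝ}
    (hf : ∀ t ∈ Icc a b, HasDerivWithinAt f (df t) (Icc a b) t)
    (hdf : ∀ t ∈ Icc a b, HasDerivWithinAt df (-lam * f t) (Icc a b) t)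
    {t : ℝ} (ht : t ∈ Icc a b) :
    f t = f a * C (t - a) + df a * S (t - a) ∧
      df t = df a * C (t - a) - lam * f a * S (t - a) := by
  have hC : ∀ x, HasDerivWithinAt (fun x => C (x - a)) (-lam * S (x - a)) (Icc a b) x := fun x =>
    ((h.deriv_C (x - a)).comp_sub_const x a).hasDerivWithinAt
  have hS : ∀ x, HasDerivWithinAt (fun x => S (x - a)) (C (x - a)) (Icc a b) x := fun x =>
    ((h.deriv_S (x - a)).comp_sub_const x a).hasDerivWithinAt
  have ha : a ∈ Icc a b := ⟨le_rfl, ht.1.trans ht.2⟩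
  have const : ∀ g : ℝ → ℝ, (∀ x ∈ Icc a b, HasDerivWithinAt g 0 (Icc a b) x) → g t = g a := by
    intro g hg
    have := (convex_Icc a b).norm_image_sub_le_of_norm_hasDerivWithin_le (C := 0) hg (by simp) ha ht
    rw [zero_mul, norm_le_zero_iff] at this
    linarith
  -- Applying the inverse transfer matrix to `(f, df)` gives two conserved quantities, namely the
  -- data at `a`; the energy identity then inverts the matrix.
  have hP := const (fun x => f x * C (x - a) - df x * S (x - a)) fun x hx => by
    refine HasDerivWithinAt.congr_deriv (((hf x hx).mul (hC x)).sub ((hdf x hx).mul (hS x))) ?_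
    ring
  have hQ := const (fun x => lam * (f x * S (x - a)) + df x * C (x - a)) fun x hx => by
    refine HasDerivWithinAt.congr_deriv
      ((((hf x hx).mul (hS x)).const_mul lam).add ((hdf x hx).mul (hC x))) ?_
    ring
  have hpy := h.sq_add (t - a)
  simp only [sub_self, h.C_zero, h.S_zero] at hP hQ
  constructor
  · linear_combination (-f t) * hpy + C (t - a) * hP + S (t - a) * hQ
  · linear_combination (-df t) * hpy + C (t - a) * hQ - lam * S (t - a) * hP

end IsFundamentalPair

theorem angleInterval_eq (i : Fin 4) : angleInterval i =
    Icc ((i : ℕ) * (Real.pi / 2)) ((i : ℕ) * (Real.pi / 2) + Real.pi / 2) := by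
  rw [angleInterval, add_mul, one_mul]

/-! ### The 2×2 system for the initial data -/

/-- The two equations for the initial data `A = ψ₁(0)` and `B = ψ₁'(0)` of a solution of the angular
problem, where `y` and `s` are the values of the fundamental pair at `π / 2`, and `a` and `b` are the
permittivities. -/
def IsCompatible (a b lam y s A B : ℝ) : Prop :=
  a * A = b * y * (A * (4 * y ^ 3 - 3 * y) + B * (s * (4 * y ^ 2 - 1))) +
      a * s * (B * (4 * y ^ 3 - 3 * y) - lam * A * (s * (4 * y ^ 2 - 1))) ∧
  b * B = a * y * (B * (4 * y ^ 3 - 3 * y) - lam * A * (s * (4 * y ^ 2 - 1))) -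
      b * lam * s * (A * (4 * y ^ 3 - 3 * y) + B * (s * (4 * y ^ 2 - 1)))

/-- The factor of the characteristic function of the angular problem, in terms of `z = y ^ 2`. -/
def charFactor (a b z : ℝ) : ℝ := (a ^ 2 + b ^ 2) * (4 * z - 3) + a * b * (8 * z - 10)

/-- Cramer's rule: `e1` and `e2` are the rows of the system once `lam * s ^ 2` is eliminated, and
`key` computes its determinant. -/
theorem IsCompatible.eq_zero {a b lam y s A B : ℝ} (h : IsCompatible a b lam y s A B)
    (hy : y ^ 2 + lam * s ^ 2 = 1) (hd : y ^ 2 * charFactor a b (y ^ 2) ≠ 0) : A = 0 ∧ B = 0 := by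
  obtain ⟨h1, h2⟩ := h
  obtain hl : lam * s ^ 2 = 1 - y ^ 2 := by linarith
  have e1 : (b * y * (4 * y ^ 3 - 3 * y) - a * (1 - y ^ 2) * (4 * y ^ 2 - 1) - a) * A +
      s * y * (b * (4 * y ^ 2 - 1) + a * (4 * y ^ 2 - 3)) * B = 0 := by
    linear_combination (-1) * h1 + a * A * (4 * y ^ 2 - 1) * hl
  have e2 : -(lam * s * y * (a * (4 * y ^ 2 - 1) + b * (4 * y ^ 2 - 3))) * A +
      (a * y * (4 * y ^ 3 - 3 * y) - b * (1 - y ^ 2) * (4 * y ^ 2 - 1) - b) * B = 0 := by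
    linear_combination (-1) * h2 + b * B * (4 * y ^ 2 - 1) * hl
  have key : (b * y * (4 * y ^ 3 - 3 * y) - a * (1 - y ^ 2) * (4 * y ^ 2 - 1) - a) *
      (a * y * (4 * y ^ 3 - 3 * y) - b * (1 - y ^ 2) * (4 * y ^ 2 - 1) - b) +
      s * y * (b * (4 * y ^ 2 - 1) + a * (4 * y ^ 2 - 3)) *
      (lam * s * y * (a * (4 * y ^ 2 - 1) + b * (4 * y ^ 2 - 3))) =
      -(y ^ 2 * charFactor a b (y ^ 2)) := by
    rw [charFactor]
    linear_combination y ^ 2 * (b * (4 * y ^ 2 - 1) + a * (4 * y ^ 2 - 3)) *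
      (a * (4 * y ^ 2 - 1) + b * (4 * y ^ 2 - 3)) * hl
  constructor
  · refine (mul_eq_zero.1 ?_).resolve_left hd
    linear_combination A * key -
      (a * y * (4 * y ^ 3 - 3 * y) - b * (1 - y ^ 2) * (4 * y ^ 2 - 1) - b) * e1 +
      s * y * (b * (4 * y ^ 2 - 1) + a * (4 * y ^ 2 - 3)) * e2
  · refine (mul_eq_zero.1 ?_).resolve_left hd
    linear_combination B * key -
      (b * y * (4 * y ^ 3 - 3 * y) - a * (1 - y ^ 2) * (4 * y ^ 2 - 1) - a) * e2 -
      (lam * s * y * (a * (4 * y ^ 2 - 1) + b * (4 * y ^ 2 - 3))) * e1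

/-- For `A = 0` only the off-diagonal term of the first equation survives. This makes the eigenvalue
below 1 simple. -/
theorem IsCompatible.right_eq_zero {a b lam y s B : ℝ} (h : IsCompatible a b lam y s 0 B)
    (hq : s * y * (b * (4 * y ^ 2 - 1) + a * (4 * y ^ 2 - 3)) ≠ 0) : B = 0 := by
  refine (mul_eq_zero.1 ?_).resolve_left hq
  linear_combination (-1) * h.1

/-- If `p A + q B = 0` is the first row, then `(q, -p)` solves it, and the vanishing determinant
gives the second row. -/
theorem exists_isCompatible {a b lam y s : ℝ} (hy : y ^ 2 + lam * s ^ 2 = 1)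
    (hd : charFactor a b (y ^ 2) = 0) :
    ∃ B, IsCompatible a b lam y s (s * y * (b * (4 * y ^ 2 - 1) + a * (4 * y ^ 2 - 3))) B := by
  obtain hl : lam * s ^ 2 = 1 - y ^ 2 := by linarith
  rw [charFactor] at hd
  refine ⟨-(b * y * (4 * y ^ 3 - 3 * y) - a * (1 - y ^ 2) * (4 * y ^ 2 - 1) - a), ?_, ?_⟩
  · linear_combination a * (s * y * (b * (4 * y ^ 2 - 1) + a * (4 * y ^ 2 - 3))) *
      (4 * y ^ 2 - 1) * hl
  · linear_combination y ^ 2 * (b * (4 * y ^ 2 - 1) + a * (4 * y ^ 2 - 3)) *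
      (a * (4 * y ^ 2 - 1) + b * (4 * y ^ 2 - 3)) * hl -
      b * (b * y * (4 * y ^ 3 - 3 * y) - a * (1 - y ^ 2) * (4 * y ^ 2 - 1) - a) *
      (4 * y ^ 2 - 1) * hl - y ^ 2 * hd

/-- At `y = 0` three quarters map `(A, B)` to `(-s B, lam s A)` up to the jump, and the last quarter
restores `(A, B)`: every datum is admissible. -/
theorem isCompatible_zero {a b lam s A B : ℝ} (hs : lam * s ^ 2 = 1) :
    IsCompatible a b lam 0 s A B := by
  constructor
  · linear_combination (-a * A) * hs
  · linear_combination (-b * B) * hs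

/-! ### Eigenfunctions and compatible initial data -/

section Eigenspace

variable {epsIn : Fin 4 → ℝ} {lam : ℝ} {C S : ℝ → ℝ} {ψ : Fin 4 → ℝ → ℝ}

/-- The initial data of an eigenfunction are compatible, and determine it. -/
theorem exists_isCompatible_of_mem (h : IsFundamentalPair lam C S) (hb : epsIn 3 ≠ 0)
    (hψ : ψ ∈ angularEigenspace epsIn lam) :
    ∃ B, IsCompatible (epsIn 0) (epsIn 3) lam (C (Real.pi / 2)) (S (Real.pi / 2)) (ψ 0 0) B ∧
      (ψ 0 0 = 0 → B = 0 → ψ = 0) := by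
  obtain ⟨h0, d, hd, ⟨a1, a2⟩, ⟨b1, b2⟩, ⟨c1, c2⟩, d1, d2⟩ := hψ
  have hpi := Real.pi_pos
  have prop : ∀ i : Fin 4, ∀ t ∈ angleInterval i,
      ψ i t = ψ i ((i : ℕ) * (Real.pi / 2)) * C (t - (i : ℕ) * (Real.pi / 2)) +
        d i ((i : ℕ) * (Real.pi / 2)) * S (t - (i : ℕ) * (Real.pi / 2)) ∧
      d i t = d i ((i : ℕ) * (Real.pi / 2)) * C (t - (i : ℕ) * (Real.pi / 2)) -
        lam * ψ i ((i : ℕ) * (Real.pi / 2)) * S (t - (i : ℕ) * (Real.pi / 2)) :=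
    fun i t ht => h.propagate (fun t ht => (hd i t ht).1) (fun t ht => (hd i t ht).2) ht
  have pend : ∀ i : Fin 4, _ := fun i => prop i ((i : ℕ) * (Real.pi / 2) + Real.pi / 2)
    (by rw [angleInterval_eq]; constructor <;> linarith)
  simp only [add_sub_cancel_left] at pend
  have p0 := pend 0
  have p1 := pend 1
  have p2 := pend 2
  have p3 := pend 3
  have s2 : (2 : ℝ) * (Real.pi / 2) = Real.pi := by ring
  have e1 : Real.pi / 2 + Real.pi / 2 = Real.pi := by ring
  have e2 : Real.pi + Real.pi / 2 = 3 / 2 * Real.pi := by ring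
  have s3 : (3 : ℝ) * (Real.pi / 2) = 3 / 2 * Real.pi := by ring
  have e3 : 3 / 2 * Real.pi + Real.pi / 2 = 2 * Real.pi := by ring
  simp only [Fin.val_zero, Fin.val_one, Fin.val_two, Nat.cast_zero, Nat.cast_one, Nat.cast_ofNat,
    zero_mul, one_mul, zero_add, s2, e1, e2, show ((3 : Fin 4) : ℕ) = 3 from rfl, s3, e3]
    at p0 p1 p2 p3
  have hpy := h.sq_add (Real.pi / 2)
  generalize C (Real.pi / 2) = y at *
  generalize S (Real.pi / 2) = s at *
  have hl : lam * s ^ 2 = 1 - y ^ 2 := by linarith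
  obtain ⟨p0, q0⟩ := p0
  obtain ⟨p1, q1⟩ := p1
  obtain ⟨p2, q2⟩ := p2
  obtain ⟨p3, q3⟩ := p3
  rw [← b1, ← b2, p0, q0] at p1 q1
  rw [← c1, ← c2, p1, q1] at p2 q2
  -- The data at 3π/2: the triple-angle formulas for `C` and `S`. In `v3` the derivative stays
  -- multiplied by `epsIn 3`, which avoids a division.
  have u3 : ψ 3 (3 / 2 * Real.pi) = ψ 0 0 * (4 * y ^ 3 - 3 * y) + d 0 0 * (s * (4 * y ^ 2 - 1)) := by
    rw [← d1, p2]
    linear_combination (-3 * y * ψ 0 0 - s * d 0 0) * hl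
  have v3 : epsIn 3 * d 3 (3 / 2 * Real.pi) =
      epsIn 0 * (d 0 0 * (4 * y ^ 3 - 3 * y) - lam * ψ 0 0 * (s * (4 * y ^ 2 - 1))) := by
    rw [← d2, q2]
    linear_combination (epsIn 0 * (-3 * y * d 0 0 + lam * s * ψ 0 0)) * hl
  refine ⟨d 0 0, ⟨?_, ?_⟩, fun hA hB => ?_⟩
  · rw [a1, p3]
    linear_combination epsIn 3 * y * u3 + s * v3
  · linear_combination epsIn 3 * a2 + epsIn 3 * q3 + y * v3 - epsIn 3 * lam * s * u3
  · have w3 : d 3 (3 / 2 * Real.pi) = 0 := by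
      refine (mul_eq_zero.1 ?_).resolve_left hb
      rw [v3, hA, hB]; ring
    have x3 : ψ 3 (3 / 2 * Real.pi) = 0 := by rw [u3, hA, hB]; ring
    -- Zero initial data propagate to the left end of every interval.
    have start : ∀ i : Fin 4, ψ i ((i : ℕ) * (Real.pi / 2)) = 0 ∧
        d i ((i : ℕ) * (Real.pi / 2)) = 0 := by
      intro i
      fin_cases i
      · simp [hA, hB]
      · simp [← b1, ← b2, p0, q0, hA, hB]
      · simp [s2, ← c1, ← c2, p1, q1, hA, hB]
      · simp [s3, w3, x3]
    funext i t
    by_cases ht : t ∈ angleInterval i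
    · rw [(prop i t ht).1, (start i).1, (start i).2]; simp
    · exact h0 i t ht

/-- The data are transported around the circle so that the conditions at π/2, π and 3π/2 hold by
construction; the two compatibility equations are the conditions that close up at 0 and 2π. -/
theorem exists_mem_angularEigenspace (h : IsFundamentalPair lam C S) (hb : epsIn 3 ≠ 0) {A B : ℝ}
    (hAB : IsCompatible (epsIn 0) (epsIn 3) lam (C (Real.pi / 2)) (S (Real.pi / 2)) A B) :
    ∃ ψ ∈ angularEigenspace epsIn lam, ψ 0 0 = A := by
  have hpi := Real.pi_pos
  let y := C (Real.pi / 2)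
  let s := S (Real.pi / 2)
  have hpy : y ^ 2 + lam * s ^ 2 = 1 := h.sq_add (Real.pi / 2)
  have hl : lam * s ^ 2 = 1 - y ^ 2 := by linarith
  -- Values `α` and derivatives `β` at the left ends of the four intervals; the division in `β 3`
  -- accounts for the jump at 3π/2.
  let α : Fin 4 → ℝ := ![A, A * y + B * s, (A * y + B * s) * y + (B * y - lam * A * s) * s,
    A * (4 * y ^ 3 - 3 * y) + B * (s * (4 * y ^ 2 - 1))]
  let β : Fin 4 → ℝ := ![B, B * y - lam * A * s,
    (B * y - lam * A * s) * y - lam * (A * y + B * s) * s,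
    epsIn 0 * (B * (4 * y ^ 3 - 3 * y) - lam * A * (s * (4 * y ^ 2 - 1))) / epsIn 3]
  let F : Fin 4 → ℝ → ℝ := fun i t =>
    α i * C (t - (i : ℕ) * (Real.pi / 2)) + β i * S (t - (i : ℕ) * (Real.pi / 2))
  let G : Fin 4 → ℝ → ℝ := fun i t =>
    β i * C (t - (i : ℕ) * (Real.pi / 2)) - lam * α i * S (t - (i : ℕ) * (Real.pi / 2))
  have hF : ∀ i t, HasDerivAt (F i) (G i t) t := fun i t => by
    refine HasDerivAt.congr_deriv
      ((((h.deriv_C (t - (i : ℕ) * (Real.pi / 2))).comp_sub_const t _).const_mul (α i)).add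
      (((h.deriv_S (t - (i : ℕ) * (Real.pi / 2))).comp_sub_const t _).const_mul (β i))) ?_
    simp only [G]; ring
  have hG : ∀ i t, HasDerivAt (G i) (-lam * F i t) t := fun i t => by
    refine HasDerivAt.congr_deriv
      ((((h.deriv_C (t - (i : ℕ) * (Real.pi / 2))).comp_sub_const t _).const_mul (β i)).sub
      (((h.deriv_S (t - (i : ℕ) * (Real.pi / 2))).comp_sub_const t _).const_mul (lam * α i))) ?_
    simp only [F]; ring
  have hFi : ∀ i, ∀ t ∈ angleInterval i, (angleInterval i).indicator (F i) t = F i t :=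
    fun i t ht => indicator_of_mem ht _
  have hl0 : ∀ i : Fin 4, ((i : ℕ) : ℝ) * (Real.pi / 2) ∈ angleInterval i := fun i => by
    rw [angleInterval_eq]; constructor <;> linarith
  have hr0 : ∀ i : Fin 4, ((i : ℕ) : ℝ) * (Real.pi / 2) + Real.pi / 2 ∈ angleInterval i :=
    fun i => by rw [angleInterval_eq]; constructor <;> linarith
  have vl : ∀ i : Fin 4, (angleInterval i).indicator (F i) ((i : ℕ) * (Real.pi / 2)) = α i :=
    fun i => by rw [hFi i _ (hl0 i)]; simp [F, h.C_zero, h.S_zero]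
  have dl : ∀ i : Fin 4, G i ((i : ℕ) * (Real.pi / 2)) = β i :=
    fun i => by simp [G, h.C_zero, h.S_zero]
  have vr : ∀ i : Fin 4, (angleInterval i).indicator (F i)
      ((i : ℕ) * (Real.pi / 2) + Real.pi / 2) = α i * y + β i * s :=
    fun i => by rw [hFi i _ (hr0 i)]; simp [F, y, s]
  have dr : ∀ i : Fin 4, G i ((i : ℕ) * (Real.pi / 2) + Real.pi / 2) =
      β i * y - lam * α i * s :=
    fun i => by simp [G, y, s]
  have s2 : (2 : ℝ) * (Real.pi / 2) = Real.pi := by ring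
  have e1 : Real.pi / 2 + Real.pi / 2 = Real.pi := by ring
  have e2 : Real.pi + Real.pi / 2 = 3 / 2 * Real.pi := by ring
  have s3 : (3 : ℝ) * (Real.pi / 2) = 3 / 2 * Real.pi := by ring
  have e3 : 3 / 2 * Real.pi + Real.pi / 2 = 2 * Real.pi := by ring
  have l0 := vl 0
  have l1 := vl 1
  have l2 := vl 2
  have l3 := vl 3
  have m0 := dl 0
  have m1 := dl 1
  have m2 := dl 2
  have m3 := dl 3
  have r0 := vr 0
  have r1 := vr 1
  have r2 := vr 2
  have r3 := vr 3
  have t0 := dr 0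
  have t1 := dr 1
  have t2 := dr 2
  have t3 := dr 3
  simp only [Fin.val_zero, Fin.val_one, Fin.val_two, Nat.cast_zero, Nat.cast_one, Nat.cast_ofNat,
    zero_mul, one_mul, zero_add, s2, e1, e2, show ((3 : Fin 4) : ℕ) = 3 from rfl, s3, e3]
    at l0 l1 l2 l3 m0 m1 m2 m3 r0 r1 r2 r3 t0 t1 t2 t3
  have α0 : α 0 = A := rfl
  have α1 : α 1 = A * y + B * s := rfl
  have α2 : α 2 = (A * y + B * s) * y + (B * y - lam * A * s) * s := rfl
  have α3 : α 3 = A * (4 * y ^ 3 - 3 * y) + B * (s * (4 * y ^ 2 - 1)) := rfl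
  have β0 : β 0 = B := rfl
  have β1 : β 1 = B * y - lam * A * s := rfl
  have β2 : β 2 = (B * y - lam * A * s) * y - lam * (A * y + B * s) * s := rfl
  have β3 : epsIn 3 * β 3 =
      epsIn 0 * (B * (4 * y ^ 3 - 3 * y) - lam * A * (s * (4 * y ^ 2 - 1))) :=
    mul_div_cancel₀ _ hb
  have hAB1 : epsIn 0 * A = epsIn 3 * y * (A * (4 * y ^ 3 - 3 * y) + B * (s * (4 * y ^ 2 - 1))) +
      epsIn 0 * s * (B * (4 * y ^ 3 - 3 * y) - lam * A * (s * (4 * y ^ 2 - 1))) := hAB.1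
  have hAB2 : epsIn 3 * B =
      epsIn 0 * y * (B * (4 * y ^ 3 - 3 * y) - lam * A * (s * (4 * y ^ 2 - 1))) -
      epsIn 3 * lam * s * (A * (4 * y ^ 3 - 3 * y) + B * (s * (4 * y ^ 2 - 1))) := hAB.2
  clear_value y s α β
  refine ⟨fun i => (angleInterval i).indicator (F i), ⟨fun i t ht => indicator_of_notMem ht _, G,
    fun i t ht => ⟨?_, ?_⟩, ⟨?_, ?_⟩, ⟨?_, ?_⟩, ⟨?_, ?_⟩, ?_, ?_⟩, ?_⟩
  · exact (hF i t).hasDerivWithinAt.congr (fun x hx => hFi i x hx) (hFi i t ht)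
  · beta_reduce; rw [hFi i t ht]; exact (hG i t).hasDerivWithinAt
  · beta_reduce; rw [l0, r3, α0, α3]
    linear_combination hAB1 - s * β3
  · rw [m0, t3, β0, α3]
    refine mul_left_cancel₀ hb ?_
    linear_combination hAB2 - y * β3
  · beta_reduce; rw [r0, l1, α0, β0, α1]
  · rw [t0, m1, α0, β0, β1]
  · beta_reduce; rw [r1, l2, α1, β1, α2]
  · rw [t1, m2, α1, β1, β2]
  · beta_reduce; rw [r2, l3, α2, β2, α3]
    linear_combination (-3 * y * A - s * B) * hl
  · rw [t2, m3, α2, β2, β3]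
    linear_combination (epsIn 0 * (-3 * y * B + lam * s * A)) * hl
  · exact l0.trans α0

end Eigenspace

/-! ### The exponent belonging to a relative jump -/

/-- The number `κ ∈ [0, 1/3)` with `cos (κ π) = (8 + J) / (8 + 2 J)`. -/
noncomputable def jumpExponent (J : ℝ) : ℝ := Real.arccos ((8 + J) / (8 + 2 * J)) / Real.pi

section JumpExponent

variable {J : ℝ}

/-- The bound 1/2 = cos(π/3) is what keeps the exponent below 1/3. -/
theorem cosRatio_mem (hJ : 0 ≤ J) :
    1 / 2 < (8 + J) / (8 + 2 * J) ∧ (8 + J) / (8 + 2 * J) ≤ 1 := by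
  constructor
  · rw [div_lt_div_iff₀ (by norm_num) (by linarith)]; linarith
  · rw [div_le_one (by linarith)]; linarith

theorem cos_jumpExponent (hJ : 0 ≤ J) :
    Real.cos (jumpExponent J * Real.pi) = (8 + J) / (8 + 2 * J) := by
  have := cosRatio_mem hJ
  rw [jumpExponent, div_mul_cancel₀ _ Real.pi_ne_zero, Real.cos_arccos (by linarith) this.2]

theorem jumpExponent_nonneg (J : ℝ) : 0 ≤ jumpExponent J :=
  div_nonneg (Real.arccos_nonneg _) Real.pi_pos.le

theorem jumpExponent_pos (hJ : 0 < J) : 0 < jumpExponent J := by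
  refine div_pos (Real.arccos_pos.2 ?_) Real.pi_pos
  rw [div_lt_one (by linarith)]; linarith

theorem jumpExponent_lt (hJ : 0 ≤ J) : jumpExponent J < 1 / 3 := by
  have hx := cosRatio_mem hJ
  have h3 : Real.arccos (1 / 2) = Real.pi / 3 := by
    rw [← Real.cos_pi_div_three]
    exact Real.arccos_cos (by linarith [Real.pi_pos]) (by linarith [Real.pi_pos])
  have := Real.arccos_lt_arccos (by norm_num) hx.1 hx.2
  rw [jumpExponent, div_lt_iff₀ Real.pi_pos]
  linarith

theorem jumpExponent_mono {J' : ℝ} (hJ : 0 ≤ J) (h : J ≤ J') :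
    jumpExponent J ≤ jumpExponent J' := by
  refine div_le_div_of_nonneg_right (Real.arccos_le_arccos ?_) Real.pi_pos.le
  rw [div_le_div_iff₀ (by linarith) (by linarith)]
  nlinarith

/-- The range up to 1 covers both the critical exponent and all eigenvalues below 1. -/
theorem eq_jumpExponent {κ : ℝ} (h0 : 0 ≤ κ) (h1 : κ ≤ 1)
    (h : Real.cos (κ * Real.pi) = (8 + J) / (8 + 2 * J)) : κ = jumpExponent J := by
  have hpi := Real.pi_pos
  rw [jumpExponent, ← h, Real.arccos_cos (by positivity) (by nlinarith)]
  field_simp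

/-- The equation that defines the critical exponent, solved for the exponent. -/
theorem jump_eq_iff {κ : ℝ} (hJ : 0 ≤ J) (hκ : κ ∈ Ico (0 : ℝ) (1 / 3)) :
    4 * Real.sin (κ * Real.pi) ^ 2 /
      (Real.cos (3 / 2 * κ * Real.pi) * Real.cos (1 / 2 * κ * Real.pi)) = J ↔
      κ = jumpExponent J := by
  have hpi := Real.pi_pos
  -- With x = cos(κπ) the defining quotient becomes 8(1 - x)(1 + x)/((2x - 1)(x + 1)). After
  -- cancelling x + 1 the equation is linear in x.
  have hden : Real.cos (3 / 2 * κ * Real.pi) * Real.cos (1 / 2 * κ * Real.pi) =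
      (2 * Real.cos (κ * Real.pi) - 1) * (Real.cos (κ * Real.pi) + 1) / 2 := by
    have h1 := Real.cos_add (κ * Real.pi) (1 / 2 * κ * Real.pi)
    have h2 := Real.cos_sub (κ * Real.pi) (1 / 2 * κ * Real.pi)
    have h3 := Real.cos_two_mul (1 / 2 * κ * Real.pi)
    have h4 := Real.sin_two_mul (1 / 2 * κ * Real.pi)
    have h5 := Real.sin_sq_add_cos_sq (1 / 2 * κ * Real.pi)
    rw [show κ * Real.pi + 1 / 2 * κ * Real.pi = 3 / 2 * κ * Real.pi by ring] at h1
    rw [show 2 * (1 / 2 * κ * Real.pi) = κ * Real.pi by ring] at h3 h4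
    rw [h1, h4, h3]
    linear_combination (-2 * Real.cos (1 / 2 * κ * Real.pi) ^ 2) * h5
  have hx : 1 / 2 < Real.cos (κ * Real.pi) := by
    rw [← Real.cos_pi_div_three]
    refine Real.cos_lt_cos_of_nonneg_of_le_pi (mul_nonneg hκ.1 hpi.le) (by linarith) ?_
    nlinarith [hκ.2]
  rw [hden, Real.sin_sq]
  have hpos : 0 < (2 * Real.cos (κ * Real.pi) - 1) * (Real.cos (κ * Real.pi) + 1) / 2 :=
    div_pos (mul_pos (by linarith) (by linarith)) two_pos
  rw [div_eq_iff hpos.ne']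
  constructor
  · intro h
    refine eq_jumpExponent hκ.1 (by linarith [hκ.2]) ?_
    rw [eq_div_iff (by linarith)]
    refine mul_left_cancel₀ (by linarith : Real.cos (κ * Real.pi) + 1 ≠ 0) ?_
    linear_combination (-2) * h
  · intro h
    have hc := cos_jumpExponent hJ
    rw [← h, eq_div_iff (by linarith)] at hc
    linear_combination (-1 / 2 * (Real.cos (κ * Real.pi) + 1)) * hc

end JumpExponent

/-! ### The spectrum of the angular problem -/

section Spectrum

variable {epsIn : Fin 4 → ℝ}

/-- At `y ^ 2 = (1 + x) / 2` with x = cos(κπ), the factor is affine in x, and its zero is the cosine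
that defines `jumpExponent`. -/
theorem charFactor_eq {a b x : ℝ} (hab : a * b ≠ 0) :
    charFactor a b ((1 + x) / 2) =
      a * b * ((8 + 2 * ((a - b) ^ 2 / (a * b))) * x - (8 + (a - b) ^ 2 / (a * b))) := by
  have ha : a ≠ 0 := left_ne_zero_of_mul hab
  have hb : b ≠ 0 := right_ne_zero_of_mul hab
  rw [charFactor]
  field_simp
  ring

theorem cos_half_sq (κ : ℝ) :
    Real.cos (κ * (Real.pi / 2)) ^ 2 = (1 + Real.cos (κ * Real.pi)) / 2 := by
  rw [Real.cos_sq, show 2 * (κ * (Real.pi / 2)) = κ * Real.pi by ring]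
  ring

theorem angularEigenspace_eq_bot {lam : ℝ} {C S : ℝ → ℝ} (h : IsFundamentalPair lam C S)
    (hb : epsIn 3 ≠ 0) (hd : C (Real.pi / 2) ^ 2 *
      charFactor (epsIn 0) (epsIn 3) (C (Real.pi / 2) ^ 2) ≠ 0) :
    angularEigenspace epsIn lam = ⊥ := by
  rw [eq_bot_iff]
  intro ψ hψ
  obtain ⟨B, hB, hz⟩ := exists_isCompatible_of_mem h hb hψ
  obtain ⟨h1, h2⟩ := hB.eq_zero (h.sq_add _) hd
  exact hz h1 h2

/-- Here `y ^ 2 ≥ 1`, and `charFactor` increases in its last argument from the value (a - b)² > 0 at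
1. -/
theorem angularEigenspace_eq_bot_of_nonpos {lam : ℝ} (ha : 0 < epsIn 0) (hb : 0 < epsIn 3)
    (hab : epsIn 0 ≠ epsIn 3) (hlam : lam ≤ 0) : angularEigenspace epsIn lam = ⊥ := by
  obtain ⟨C, S, h⟩ := exists_isFundamentalPair_of_nonpos hlam
  refine angularEigenspace_eq_bot h hb.ne' ?_
  have hy : 1 ≤ C (Real.pi / 2) ^ 2 := by
    nlinarith [h.sq_add (Real.pi / 2), sq_nonneg (S (Real.pi / 2))]
  refine mul_ne_zero (by linarith) (ne_of_gt ?_)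
  have h1 : 0 < (epsIn 0 - epsIn 3) ^ 2 := by
    have := sub_ne_zero.2 hab
    positivity
  have h2 := mul_pos ha hb
  rw [charFactor]
  nlinarith [mul_nonneg (add_nonneg (sq_nonneg (epsIn 0)) (sq_nonneg (epsIn 3))) (sub_nonneg.2 hy),
    mul_nonneg h2.le (sub_nonneg.2 hy)]

theorem angularEigenspace_eq_bot_of_ne {κ : ℝ} (ha : 0 < epsIn 0) (hb : 0 < epsIn 3)
    (h0 : 0 < κ) (h1 : κ < 1)
    (hκ : κ ≠ jumpExponent ((epsIn 0 - epsIn 3) ^ 2 / (epsIn 0 * epsIn 3))) :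
    angularEigenspace epsIn (κ ^ 2) = ⊥ := by
  have hpi := Real.pi_pos
  have hc : 0 < Real.cos (κ * (Real.pi / 2)) :=
    Real.cos_pos_of_mem_Ioo ⟨by nlinarith, by nlinarith⟩
  refine angularEigenspace_eq_bot (isFundamentalPair_cos h0.ne') hb.ne'
    (mul_ne_zero (by positivity) ?_)
  have hab := (mul_pos ha hb).ne'
  have hJ : 0 ≤ (epsIn 0 - epsIn 3) ^ 2 / (epsIn 0 * epsIn 3) := by positivity
  simp only [cos_half_sq]
  rw [charFactor_eq hab]
  refine mul_ne_zero hab fun h => hκ (eq_jumpExponent h0.le h1.le ?_)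
  rw [eq_div_iff (by linarith)]
  linarith

/-- The data of the fundamental pair at the smallest eigenvalue. -/
theorem jumpExponent_spec {a b : ℝ} (ha : 0 < a) (hb : 0 < b) (hab : a ≠ b) {κ : ℝ}
    (hκ : κ = jumpExponent ((a - b) ^ 2 / (a * b))) :
    0 < κ ∧ κ < 1 ∧ charFactor a b (Real.cos (κ * (Real.pi / 2)) ^ 2) = 0 ∧
      Real.sin (κ * (Real.pi / 2)) / κ * Real.cos (κ * (Real.pi / 2)) *
        (b * (4 * Real.cos (κ * (Real.pi / 2)) ^ 2 - 1) +
          a * (4 * Real.cos (κ * (Real.pi / 2)) ^ 2 - 3)) ≠ 0 := by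
  have hpi := Real.pi_pos
  have hsub := sub_ne_zero.2 hab
  have hJ : 0 < (a - b) ^ 2 / (a * b) := by positivity
  have h0 : 0 < κ := hκ ▸ jumpExponent_pos hJ
  have h1 : κ < 1 := hκ ▸ (jumpExponent_lt hJ.le).trans (by norm_num)
  have hx := cosRatio_mem hJ.le
  have hcos := cos_jumpExponent hJ.le
  rw [← hκ] at hcos
  have hc : 0 < Real.cos (κ * (Real.pi / 2)) :=
    Real.cos_pos_of_mem_Ioo ⟨by nlinarith, by nlinarith⟩
  have hs : 0 < Real.sin (κ * (Real.pi / 2)) :=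
    Real.sin_pos_of_pos_of_lt_pi (by positivity) (by nlinarith)
  refine ⟨h0, h1, ?_, ne_of_gt (mul_pos (mul_pos (div_pos hs h0) hc) ?_)⟩
  · rw [cos_half_sq, charFactor_eq (mul_pos ha hb).ne', hcos]
    rw [mul_div_cancel₀ _ (by linarith), sub_self, mul_zero]
  -- With x = cos(κπ) > 1/2 the bracket equals b(2x + 1) + a(2x - 1).
  · rw [cos_half_sq, hcos]
    refine add_pos (mul_pos hb ?_) (mul_pos ha ?_) <;> linarith

theorem exists_ne_zero_mem_jumpExponent (ha : 0 < epsIn 0) (hb : 0 < epsIn 3)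
    (hab : epsIn 0 ≠ epsIn 3) :
    ∃ ψ ∈ angularEigenspace epsIn
      (jumpExponent ((epsIn 0 - epsIn 3) ^ 2 / (epsIn 0 * epsIn 3)) ^ 2), ψ ≠ 0 := by
  obtain ⟨h0, h1, hd, hq⟩ := jumpExponent_spec ha hb hab rfl
  have hp := isFundamentalPair_cos h0.ne'
  obtain ⟨B, hB⟩ := exists_isCompatible (hp.sq_add (Real.pi / 2)) hd
  obtain ⟨ψ, hψ, hψ0⟩ := exists_mem_angularEigenspace hp hb.ne' hB
  refine ⟨ψ, hψ, ?_⟩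
  rintro rfl
  exact hq hψ0.symm

/-- The functional `ψ ↦ ψ 0 0` is injective on the eigenspace, since `ψ 0 0 = 0` forces the initial
derivative to vanish too. -/
theorem rank_angularEigenspace_jumpExponent_le_one (ha : 0 < epsIn 0) (hb : 0 < epsIn 3)
    (hab : epsIn 0 ≠ epsIn 3) :
    Module.rank ℝ ↥(angularEigenspace epsIn
      (jumpExponent ((epsIn 0 - epsIn 3) ^ 2 / (epsIn 0 * epsIn 3)) ^ 2)) ≤ 1 := by
  obtain ⟨h0, h1, hd, hq⟩ := jumpExponent_spec ha hb hab rfl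
  have hp := isFundamentalPair_cos h0.ne'
  generalize jumpExponent ((epsIn 0 - epsIn 3) ^ 2 / (epsIn 0 * epsIn 3)) = κ at *
  let ev : (Fin 4 → ℝ → ℝ) →ₗ[ℝ] ℝ := LinearMap.proj 0 ∘ₗ LinearMap.proj 0
  have hinj : Function.Injective (ev ∘ₗ (angularEigenspace epsIn (κ ^ 2)).subtype) := by
    rw [← LinearMap.ker_eq_bot, LinearMap.ker_eq_bot']
    rintro ⟨ψ, hψ⟩ h
    have hA : ψ 0 0 = 0 := h
    obtain ⟨B, hB, hz⟩ := exists_isCompatible_of_mem hp hb.ne' hψ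
    rw [hA] at hB
    exact Subtype.ext (hz hA (hB.right_eq_zero hq))
  simpa using LinearMap.rank_le_of_injective _ hinj

theorem exists_ne_zero_mem_one (hb : epsIn 3 ≠ 0) :
    ∃ ψ ∈ angularEigenspace epsIn 1, ψ ≠ 0 := by
  have hp := isFundamentalPair_cos one_ne_zero
  have hc : IsCompatible (epsIn 0) (epsIn 3) (1 ^ 2) (Real.cos (1 * (Real.pi / 2)))
      (Real.sin (1 * (Real.pi / 2)) / 1) 1 0 := by
    have : Real.cos (1 * (Real.pi / 2)) = 0 := by simp
    rw [this]
    exact isCompatible_zero (by simp)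
  obtain ⟨ψ, hψ, hψ0⟩ := exists_mem_angularEigenspace hp hb hc
  rw [one_pow] at hψ
  refine ⟨ψ, hψ, ?_⟩
  rintro rfl
  exact zero_ne_one hψ0

/-- Eigenspaces to different parameters meet only in zero. -/
theorem eq_zero_of_mem_of_mem {lam mu : ℝ} {ψ : Fin 4 → ℝ → ℝ} (h : lam ≠ mu)
    (h1 : ψ ∈ angularEigenspace epsIn lam) (h2 : ψ ∈ angularEigenspace epsIn mu) : ψ = 0 := by
  obtain ⟨h0, d, hd, -⟩ := h1
  obtain ⟨-, e, he, -⟩ := h2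
  funext i t
  by_cases ht : t ∈ angleInterval i
  · have hu : UniqueDiffOn ℝ (angleInterval i) := by
      rw [angleInterval_eq]
      exact uniqueDiffOn_Icc (by linarith [Real.pi_pos])
    have hde : ∀ x ∈ angleInterval i, d i x = e i x := fun x hx =>
      (hu x hx).eq_deriv _ (hd i x hx).1 (he i x hx).1
    have := (hu t ht).eq_deriv _ (hd i t ht).2 (((he i t ht).2).congr hde (hde t ht))
    have h3 : (lam - mu) * ψ i t = 0 := by linarith
    exact (mul_eq_zero.1 h3).resolve_left (sub_ne_zero.2 h)
  · exact h0 i t ht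

/-- If `lam < mu` were both the `n`-th eigenvalue, the span up to `lam`, of dimension at least `n`,
would lie in the span below `mu`, of dimension less than `n`. -/
theorem IsNthAngularExponent.unique {n : ℕ} {κ κ' : ℝ} (h : IsNthAngularExponent epsIn n κ)
    (h' : IsNthAngularExponent epsIn n κ') : κ = κ' := by
  have key : ∀ {lam mu : ℝ}, IsNthAngularEigenvalue epsIn n lam →
      IsNthAngularEigenvalue epsIn n mu → ¬ lam < mu := by
    intro lam mu h1 h2 hlt
    refine absurd (h1.2.trans (Submodule.rank_mono ?_)) (not_le.2 h2.1)
    exact iSup₂_le fun lam' hl => le_iSup₂_of_le lam' (hl.trans_lt hlt) le_rfl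
  have hsq : κ ^ 2 = κ' ^ 2 := le_antisymm (not_lt.1 (key h'.2 h.2)) (not_lt.1 (key h.2 h'.2))
  exact (pow_left_inj₀ h.1 h'.1 two_ne_zero).1 hsq

theorem angularEigenspace_eq_bot_of_lt_one (ha : 0 < epsIn 0) (hb : 0 < epsIn 3)
    (hab : epsIn 0 ≠ epsIn 3) {lam' : ℝ} (hlam : lam' < 1)
    (hne : lam' ≠ jumpExponent ((epsIn 0 - epsIn 3) ^ 2 / (epsIn 0 * epsIn 3)) ^ 2) :
    angularEigenspace epsIn lam' = ⊥ := by
  rcases le_or_gt lam' 0 with h0 | h0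
  · exact angularEigenspace_eq_bot_of_nonpos ha hb hab h0
  · have hs := Real.sq_sqrt h0.le
    rw [← hs] at hne ⊢
    refine angularEigenspace_eq_bot_of_ne ha hb (Real.sqrt_pos.2 h0) ?_ ?_
    · rw [Real.sqrt_lt' one_pos]; linarith
    · rintro h; exact hne (by rw [← h])

theorem isNthAngularExponent_one (ha : 0 < epsIn 0) (hb : 0 < epsIn 3)
    (hab : epsIn 0 ≠ epsIn 3) : IsNthAngularExponent epsIn 1
      (jumpExponent ((epsIn 0 - epsIn 3) ^ 2 / (epsIn 0 * epsIn 3))) := by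
  obtain ⟨h0, h1, -⟩ := jumpExponent_spec ha hb hab rfl
  obtain ⟨ψ, hψ, hψ0⟩ := exists_ne_zero_mem_jumpExponent ha hb hab
  refine ⟨h0.le, ?_, ?_⟩
  · have : (⨆ (lam' : ℝ) (_ : lam' < jumpExponent
        ((epsIn 0 - epsIn 3) ^ 2 / (epsIn 0 * epsIn 3)) ^ 2), angularEigenspace epsIn lam') = ⊥ := by
      rw [eq_bot_iff]
      refine iSup₂_le fun lam' hl => ?_
      rw [angularEigenspace_eq_bot_of_lt_one ha hb hab (hl.trans (by nlinarith)) hl.ne]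
    rw [this]
    simp
  · rw [Nat.cast_one, Cardinal.one_le_iff_pos, rank_pos_iff_exists_ne_zero]
    have hle : angularEigenspace epsIn _ ≤ _ :=
      le_iSup₂_of_le (f := fun (lam' : ℝ) (_ : lam' ≤ jumpExponent
        ((epsIn 0 - epsIn 3) ^ 2 / (epsIn 0 * epsIn 3)) ^ 2) => angularEigenspace epsIn lam')
        _ le_rfl le_rfl
    exact ⟨⟨ψ, hle hψ⟩, fun h => hψ0 (congrArg Subtype.val h)⟩

/-- Below 1 there is only one eigenvalue, and it is simple; an eigenfunction at 1 supplies the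
second dimension. -/
theorem isNthAngularExponent_two (ha : 0 < epsIn 0) (hb : 0 < epsIn 3)
    (hab : epsIn 0 ≠ epsIn 3) : IsNthAngularExponent epsIn 2 1 := by
  obtain ⟨h0, h1, -⟩ := jumpExponent_spec ha hb hab rfl
  obtain ⟨ψ, hψ, hψ0⟩ := exists_ne_zero_mem_jumpExponent ha hb hab
  obtain ⟨φ, hφ, hφ0⟩ := exists_ne_zero_mem_one (epsIn := epsIn) hb.ne'
  have hrank := rank_angularEigenspace_jumpExponent_le_one ha hb hab
  have hone : ∀ lam' : ℝ, lam' < 1 → lam' ≠ _ → _ := fun lam' =>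
    angularEigenspace_eq_bot_of_lt_one (lam' := lam') ha hb hab
  generalize jumpExponent ((epsIn 0 - epsIn 3) ^ 2 / (epsIn 0 * epsIn 3)) = κ at *
  refine ⟨zero_le_one, ?_, ?_⟩
  · refine (Submodule.rank_mono (t := angularEigenspace epsIn (κ ^ 2)) ?_).trans_lt
      (hrank.trans_lt (by exact_mod_cast one_lt_two))
    refine iSup₂_le fun lam' hl => ?_
    by_cases hne : lam' = κ ^ 2
    · rw [hne]
    · rw [hone lam' (by simpa using hl) hne]
      exact bot_le
  · have hle : ∀ lam' ≤ (1 : ℝ) ^ 2, angularEigenspace epsIn lam' ≤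
        ⨆ (lam' : ℝ) (_ : lam' ≤ (1 : ℝ) ^ 2), angularEigenspace epsIn lam' := fun lam' hl =>
      le_iSup₂_of_le (f := fun (lam' : ℝ) (_ : lam' ≤ (1 : ℝ) ^ 2) => angularEigenspace epsIn lam')
        lam' hl le_rfl
    have hli : LinearIndependent ℝ ![(⟨ψ, hle (κ ^ 2) (by nlinarith) hψ⟩ :
        ↥(⨆ (lam' : ℝ) (_ : lam' ≤ (1 : ℝ) ^ 2), angularEigenspace epsIn lam')),
        ⟨φ, hle 1 (by norm_num) hφ⟩] := by
      rw [LinearIndependent.pair_iff]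
      intro s t hst
      have hst' : s • ψ + t • φ = 0 := congrArg Subtype.val hst
      -- By the relation, `s • ψ = -(t • φ)` lies in both eigenspaces.
      have hsψ : s • ψ = 0 := by
        refine eq_zero_of_mem_of_mem (lam := κ ^ 2) (mu := 1) (by nlinarith)
          (Submodule.smul_mem _ s hψ) ?_
        rw [eq_neg_of_add_eq_zero_left hst']
        exact Submodule.neg_mem _ (Submodule.smul_mem _ t hφ)
      rw [hsψ, zero_add] at hst'
      exact ⟨(smul_eq_zero.1 hsψ).resolve_right hψ0, (smul_eq_zero.1 hst').resolve_right hφ0⟩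
    simpa using hli.cardinal_le_rank

end Spectrum

/-! ### The geometry near an edge -/

namespace MaterialDomain

variable {L K : ℕ} (M : MaterialDomain L K)

theorem relJump_nonneg (i : Fin L) (l : Fin K) : 0 ≤ M.relJump i l :=
  div_nonneg (sq_nonneg _) (mul_pos (M.eps_pos _ _) (M.eps_pos _ _)).le

theorem existsUnique_isCriticalExponent (i₀ : Fin L) (l₀ : Fin K) :
    ∃! κ : ℝ, M.IsCriticalExponent κ := by
  have hne : (range fun q : Fin L × Fin K => M.relJump q.1 q.2).Nonempty := ⟨_, (i₀, l₀), rfl⟩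
  obtain ⟨J, hJ⟩ : ∃ J, IsGreatest (range fun q : Fin L × Fin K => M.relJump q.1 q.2) J :=
    ⟨_, (finite_range _).isCompact.isGreatest_sSup hne⟩
  obtain ⟨q, hq⟩ := hJ.1
  have hJ0 : 0 ≤ J := hq ▸ M.relJump_nonneg q.1 q.2
  have hmem : jumpExponent J ∈ Ico (0 : ℝ) (1 / 3) := ⟨jumpExponent_nonneg J, jumpExponent_lt hJ0⟩
  refine ⟨jumpExponent J, ⟨hmem, ?_⟩, fun κ hκ => ?_⟩
  · rw [(jump_eq_iff hJ0 hmem).2 rfl]; exact hJ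
  · exact (jump_eq_iff hJ0 hκ.1).1 (hκ.2.unique hJ)

variable {M} in
theorem IsCriticalExponent.jumpExponent_le {κ : ℝ} (hκ : M.IsCriticalExponent κ) (i : Fin L)
    (l : Fin K) : jumpExponent (M.relJump i l) ≤ κ := by
  have hle := hκ.2.2 ⟨(i, l), rfl⟩
  have h0 := M.relJump_nonneg i l
  rw [(jump_eq_iff (h0.trans hle) hκ.1).1 rfl]
  exact jumpExponent_mono h0 hle

/-- The closed interval is needed because embedded subdomains are described through a closure. -/
theorem submedium_fst_mem {i : Fin L} {j : Fin (K + 1)} {x : Fin 3 → ℝ}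
    (hx : x ∈ M.submedium i j) : x 0 ∈ Icc (M.cut i.castSucc) (M.cut i.succ) := by
  induction j using Fin.cases with
  | zero =>
    have hx : x ∈ M.slab i := hx.1
    exact ⟨hx.1.1.le, hx.1.2.le⟩
  | succ l =>
    obtain ⟨G, -, -, hG, hs⟩ := M.sub_grid i l
    have hx : x ∈ M.sub i l := hx
    rw [hs] at hx
    have hcl : IsClosed {x : Fin 3 → ℝ | x 0 ∈ Icc (M.cut i.castSucc) (M.cut i.succ)} :=
      isClosed_Icc.preimage (continuous_apply 0)
    refine closure_minimal ?_ hcl (interior_subset hx)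
    refine sUnion_subset fun C hC y hy => ?_
    obtain ⟨a, b, -, h1, h2, -, -, -, -, rfl⟩ := hG C hC
    exact ⟨h1.trans (hy 0).1.le, (hy 0).2.le.trans h2⟩

/-- The cuboids of the chain are ordered as the first coordinates of the points of their
submedia. -/
theorem le_of_submedium {i i' : Fin L} {j j' : Fin (K + 1)} {x x' : Fin 3 → ℝ}
    (hx : x ∈ M.submedium i j) (hx' : x' ∈ M.submedium i' j') (h : x 0 < x' 0) : i ≤ i' := by
  by_contra! hlt
  have h1 := M.submedium_fst_mem hx
  have h2 := M.submedium_fst_mem hx'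
  have h3 : M.cut i'.succ ≤ M.cut i.castSucc := by
    refine M.cut_strictMono.monotone ?_
    rw [Fin.le_def]
    simpa using hlt
  linarith [h1.1, h2.2]

theorem mem_cuboid_iff {a b x : Fin 3 → ℝ} :
    x ∈ cuboid a b ↔ (a 0 < x 0 ∧ x 0 < b 0) ∧ (a 1 < x 1 ∧ x 1 < b 1) ∧ (a 2 < x 2 ∧ x 2 < b 2) := by
  simp [cuboid, Fin.forall_fin_succ]

theorem mem_closure_cuboid {a b x : Fin 3 → ℝ} (hab : ∀ j, a j < b j)
    (hx : ∀ j, a j ≤ x j ∧ x j ≤ b j) : x ∈ closure (cuboid a b) := by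
  have : cuboid a b = univ.pi fun j => Ioo (a j) (b j) := by
    ext y; simp [cuboid]
  rw [this, closure_pi_set]
  intro j _
  beta_reduce
  rw [closure_Ioo (hab j).ne]
  exact hx j

/-- Two cuboids with the same extent in the first and the third direction that touch in the second
direction, and that carry different values of the permittivity, belong to an embedded subdomain and
its surrounding. -/
theorem exists_relJump_of_adjacent {c d y r : ℝ} (hcd : c < d) (hr : 0 < r) {i i' : Fin L}
    {j j' : Fin (K + 1)}
    (h1 : cuboid ![c, y, M.lo 2] ![d, y + r, M.hi 2] ⊆ M.submedium i j)
    (h2 : cuboid ![c, y - r, M.lo 2] ![d, y, M.hi 2] ⊆ M.submedium i' j')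
    (hne : M.eps i j ≠ M.eps i' j') :
    ∃ l, M.relJump i l =
      (M.eps i j - M.eps i' j') ^ 2 / (M.eps i j * M.eps i' j') := by
  have h3 := M.lo_lt_hi 2
  have mem1 : ∀ x, c < x → x < d →
      ![x, y + r / 2, (M.lo 2 + M.hi 2) / 2] ∈ M.submedium i j := fun x hx hx' => h1 <| by
    rw [mem_cuboid_iff]
    refine ⟨⟨hx, hx'⟩, ⟨?_, ?_⟩, ?_, ?_⟩ <;> simp <;> linarith
  have mem2 : ∀ x, c < x → x < d →
      ![x, y - r / 2, (M.lo 2 + M.hi 2) / 2] ∈ M.submedium i' j' := fun x hx hx' => h2 <| by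
    rw [mem_cuboid_iff]
    refine ⟨⟨hx, hx'⟩, ⟨?_, ?_⟩, ?_, ?_⟩ <;> simp <;> linarith
  -- Two abscissas in `(c, d)`, used with either cuboid on the left, give both inequalities between
  -- `i` and `i'`.
  have hlt : (2 * c + d) / 3 < (c + 2 * d) / 3 := by linarith
  have hii : i = i' := le_antisymm
    (M.le_of_submedium (mem1 ((2 * c + d) / 3) (by linarith) (by linarith))
      (mem2 ((c + 2 * d) / 3) (by linarith) (by linarith)) hlt)
    (M.le_of_submedium (mem2 ((2 * c + d) / 3) (by linarith) (by linarith))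
      (mem1 ((c + 2 * d) / 3) (by linarith) (by linarith)) hlt)
  subst hii
  have hjj : j ≠ j' := fun h => hne (by rw [h])
  induction j using Fin.cases with
  | zero =>
    obtain ⟨l, rfl⟩ := Fin.exists_succ_eq.2 hjj.symm
    refine ⟨l, ?_⟩
    rw [relJump, mul_comm, ← neg_sq, neg_sub]
  | succ l =>
    induction j' using Fin.cases with
    | zero => exact ⟨l, rfl⟩
    | succ l' =>
      -- Two different embedded subdomains are impossible: the midpoint of the common face would lie
      -- in both closures.
      have hll : l ≠ l' := fun h => hjj (by rw [h])
      refine absurd rfl (((M.sub_separated i l l' hll).ne_of_mem (closure_mono h1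
        (mem_closure_cuboid (x := ![(c + d) / 2, y, (M.lo 2 + M.hi 2) / 2]) ?_ ?_))
        (closure_mono h2 (mem_closure_cuboid ?_ ?_))))
      all_goals
        intro j
        fin_cases j <;> simp
      all_goals first | linarith | (constructor <;> linarith)

variable {M} in
/-- At an edge with one deviating value of the permittivity, the jump is that between an embedded
subdomain and its surrounding. -/
theorem IsEdgeRepresentative.exists_relJump {p : Fin 2 → ℝ} {epsIn : Fin 4 → ℝ}
    (hedge : M.IsEdgeRepresentative p epsIn)
    (hstrong : epsIn 0 = epsIn 1 ∧ epsIn 1 = epsIn 2 ∧ epsIn 2 ≠ epsIn 3) :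
    0 < epsIn 0 ∧ 0 < epsIn 3 ∧ epsIn 0 ≠ epsIn 3 ∧ ∃ i l,
      M.relJump i l = (epsIn 0 - epsIn 3) ^ 2 / (epsIn 0 * epsIn 3) := by
  obtain ⟨-, -, r, hr, k, hk⟩ := hedge
  obtain ⟨e01, e12, e23⟩ := hstrong
  obtain ⟨i0, j0, q0, v0⟩ := hk 0
  obtain ⟨i1, j1, q1, v1⟩ := hk 1
  obtain ⟨i2, j2, q2, v2⟩ := hk 2
  obtain ⟨i3, j3, q3, v3⟩ := hk 3
  have e02 := e01.trans e12
  have hne : epsIn 0 ≠ epsIn 3 := e02 ▸ e23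
  refine ⟨v0 ▸ M.eps_pos _ _, v3 ▸ M.eps_pos _ _, hne, ?_⟩
  have hright : p 0 < p 0 + r := by linarith
  have hleft : p 0 - r < p 0 := by linarith
  have hflip : (epsIn 0 - epsIn 3) ^ 2 / (epsIn 0 * epsIn 3) =
      (epsIn 3 - epsIn 0) ^ 2 / (epsIn 3 * epsIn 0) := by
    rw [mul_comm, ← neg_sq, neg_sub]
  -- The deviating value sits in quadrant `3 + k`. Its neighbour across the plane x₂ = `p 1` carries
  -- the index 0 for even `k` and 2 for odd `k`. Across x₁ = `p 0` the neighbour might belong to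
  -- another cuboid of the chain.
  fin_cases k
  · obtain ⟨l, hl⟩ := M.exists_relJump_of_adjacent hright hr q0 q3 (by rwa [← v0, ← v3])
    exact ⟨i0, l, by rw [hl, v0, v3]⟩
  · obtain ⟨l, hl⟩ := M.exists_relJump_of_adjacent hright hr q3 q2
      (by rw [← v2, ← v3]; exact e23.symm)
    exact ⟨i3, l, by rw [hl, hflip, e02, v2, v3]⟩
  · obtain ⟨l, hl⟩ := M.exists_relJump_of_adjacent hleft hr q3 q0
      (by rw [← v0, ← v3]; exact hne.symm)
    exact ⟨i3, l, by rw [hl, hflip, v0, v3]⟩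
  · obtain ⟨l, hl⟩ := M.exists_relJump_of_adjacent hleft hr q2 q3 (by rwa [← v2, ← v3])
    exact ⟨i2, l, by rw [hl, e02, v2, v3]⟩

end MaterialDomain

theorem lemma3p3 {L K : ℕ} (M : MaterialDomain L K) (p : Fin 2 → ℝ) (epsIn : Fin 4 → ℝ)
    (hedge : M.IsEdgeRepresentative p epsIn)
    (hstrong : epsIn 0 = epsIn 1 ∧ epsIn 1 = epsIn 2 ∧ epsIn 2 ≠ epsIn 3) :
    (∃! κ : ℝ, M.IsCriticalExponent κ) ∧
    (∃! κ₁ : ℝ, IsNthAngularExponent epsIn 1 κ₁) ∧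
    (∃! κ₂ : ℝ, IsNthAngularExponent epsIn 2 κ₂) ∧
    ∀ κ κ₁ κ₂ : ℝ, M.IsCriticalExponent κ →
      IsNthAngularExponent epsIn 1 κ₁ → IsNthAngularExponent epsIn 2 κ₂ →
      κ₁ ≤ κ ∧ κ < 1 ∧ 1 ≤ κ₂ := by
  obtain ⟨ha, hb, hab, i, l, hJ⟩ := hedge.exists_relJump hstrong
  have h1 := isNthAngularExponent_one ha hb hab
  have h2 := isNthAngularExponent_two ha hb hab
  refine ⟨M.existsUnique_isCriticalExponent i l, ⟨_, h1, fun κ h => h.unique h1⟩,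
    ⟨_, h2, fun κ h => h.unique h2⟩, fun κ κ₁ κ₂ hκ hκ₁ hκ₂ => ⟨?_, ?_, ?_⟩⟩
  · rw [hκ₁.unique h1, ← hJ]
    exact hκ.jumpExponent_le i l
  · exact hκ.1.2.trans (by norm_num)
  · exact (hκ₂.unique h2).ge
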